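/- All graphs are finite, undirected, without loops or parallel edges; $N_\Gamma(u)$ is the neighbourhood of a vertex $u$ and $\deg_\Gamma(u)=|N_\Gamma(u)|$. A graph is $R$-thin if distinct vertices have distinct neighbourhoods. The direct product $\Gamma\times\Sigma$ has vertex set $V(\Gamma)\times V(\Sigma)$, with $(u,v)$ adjacent to $(x,y)$ if and only if $u$ is adjacent to $x$ in $\Gamma$ and $v$ is adjacent to $y$ in $\Sigma$. The pair $(\Gamma,\Sigma)$ is stable if the groups $\mathrm{Aut}(\Gamma)\times\mathrm{Aut}(\Sigma)$ and $\mathrm{Aut}(\Gamma\times\Sigma)$ are isomorphic, and unstable otherwise. $\Gamma$ and $\Sigma$ are coprime if there is no graph $\Delta$ with at least two vertices such that $\Gamma\cong\Gamma'\times\Delta$ and $\Sigma\cong\Sigma'\times\Delta$ for some graphs $\Gamma',\Sigma'$. An unstable pair $(\Gamma,\Sigma)$ is nontrivially unstable if $\Gamma$ and $\Sigma$ are $R$-thin, connected and coprime, and at least one of them is non-bipartite. For a graph $\Gamma$, let $\Gamma^*$ be the graph on $V(\Gamma)$ in which distinct $u,v$ are adjacent if and only if $\deg_\Gamma(u)=\deg_\Gamma(v)=2|N_\Gamma(u)\cap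 N_\Gamma(v)|$. For $u\in V(\Gamma)$ let $L(u)=\{0\}$ if $u$ is isolated in $\Gamma^*$, $L(u)=\{0,1\}$ if $u$ has degree $1$ in $\Gamma^*$, and otherwise let $L(u)$ be the set of lengths of the cycles of $\Gamma^*$ containing $u$. An integer $n\ge 3$ is compatible with $\Gamma$ if either $n$ is odd and $n\notin L(u)$ for at least one $u\in V(\Gamma)$, or $n$ is even and $n/2\notin L(u)$ for at least one $u\in V(\Gamma)$. Let $K_2$ be the complete graph on two vertices and $C_n$ the cycle with $n\ge 3$ vertices. **Theorem.** Let $\Gamma$ be an $R$-thin connected non-bipartite graph. (a) $(\Gamma,K_2)$ is unstable if and only if $(\Gamma,C_{2k})$ is unstable for every integer $k\ge 2$ (that is, for all such $k$ simultaneously). (b) If $k\ge 3$ is an integer such that $2k$ is compatible with $\Gamma$, then $(\Gamma,C_{2k})$ is nontrivially unstable if and only if $(\Gamma,K_2)$ is unstable. (c) If there exists an integer $k\ge 3$ such that $2k$ is compatible with $\Gamma$ and $(\Gamma,C_{2k})$ is nontrivially unstable, then $(\Gamma,C_{2l})$ is unstable for every integer $l\ge 3$. -/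

import Mathlib

namespace GraphPair

/-- The direct (tensor) product of graphs: `(u, v)` and `(x, y)` are adjacent if and only if
`u ~ x` in the first factor and `v ~ y` in the second. -/
def directProd {V W : Type*} (G : SimpleGraph V) (H : SimpleGraph W) :
    SimpleGraph (V × W) where
  Adj p q := G.Adj p.1 q.1 ∧ H.Adj p.2 q.2
  symm := ⟨fun _ _ h => ⟨h.1.symm, h.2.symm⟩⟩
  loopless := ⟨fun p h => G.loopless.irrefl p.1 h.1⟩

/-- A graph is `R`-thin if distinct vertices have distinct neighbourhoods. -/
def RThin {V : Type*} (G : SimpleGraph V) : Prop :=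
  ∀ u v : V, u ≠ v → G.neighborSet u ≠ G.neighborSet v

/-- The pair `(G, H)` is stable if `Aut G × Aut H` and `Aut (G × H)` are isomorphic groups. -/
def Stable {V W : Type*} (G : SimpleGraph V) (H : SimpleGraph W) : Prop :=
  Nonempty (((G ≃g G) × (H ≃g H)) ≃* (directProd G H ≃g directProd G H))

/-- A pair of graphs is unstable if it is not stable. -/
def Unstable {V W : Type*} (G : SimpleGraph V) (H : SimpleGraph W) : Prop :=
  ¬ Stable G H

/-- `G` and `H` are coprime for the direct product: there is no finite graph `D` with at least two
vertices such that `G ≅ A × D` and `H ≅ B × D` for some finite graphs `A` and `B`. Every finite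
graph is isomorphic to a graph on some `Fin n`, so `A`, `B`, `D` range over all finite graphs. -/
def Coprime {V W : Type*} (G : SimpleGraph V) (H : SimpleGraph W) : Prop :=
  ¬ ∃ (a b d : ℕ) (A : SimpleGraph (Fin a)) (B : SimpleGraph (Fin b)) (D : SimpleGraph (Fin d)),
      2 ≤ d ∧ Nonempty (G ≃g directProd A D) ∧ Nonempty (H ≃g directProd B D)

/-- An unstable pair is nontrivially unstable if both graphs are `R`-thin and connected, they are
coprime, and at least one of them is non-bipartite. -/
def NontriviallyUnstable {V W : Type*} (G : SimpleGraph V) (H : SimpleGraph W) : Prop :=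
  Unstable G H ∧ RThin G ∧ RThin H ∧ G.Connected ∧ H.Connected ∧ Coprime G H ∧
    (¬ G.IsBipartite ∨ ¬ H.IsBipartite)

/-- The degree of a vertex, as the number of its neighbours. -/
noncomputable def deg {V : Type*} (G : SimpleGraph V) (u : V) : ℕ :=
  (G.neighborSet u).ncard

/-- The auxiliary graph `G*` on the vertices of `G`: distinct `u`, `v` are adjacent if and only if
`deg u = deg v = 2 |N(u) ∩ N(v)|`. -/
def auxGraph {V : Type*} (G : SimpleGraph V) : SimpleGraph V where
  Adj u v := u ≠ v ∧ deg G u = deg G v ∧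
    deg G v = 2 * (G.neighborSet u ∩ G.neighborSet v).ncard
  symm := ⟨fun u v h => ⟨h.1.symm, h.2.1.symm, by rw [Set.inter_comm, ← h.2.2, h.2.1]⟩⟩
  loopless := ⟨fun _ h => h.1 rfl⟩

/-- The set `L(u)`: `{0}` if `u` is isolated in `G*`, `{0, 1}` if `u` has degree one in `G*`, and
otherwise the set of lengths of the cycles of `G*` that contain `u`. -/
noncomputable def L {V : Type*} (G : SimpleGraph V) (u : V) : Set ℕ :=
  if deg (auxGraph G) u = 0 then {0}
  else if deg (auxGraph G) u = 1 then {0, 1}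
  else {m | ∃ p : (auxGraph G).Walk u u, p.IsCycle ∧ p.length = m}

/-- An integer `n ≥ 3` is compatible with `G` if `n` is odd and `n ∉ L(u)` for some vertex `u`, or
`n` is even and `n / 2 ∉ L(u)` for some vertex `u`. -/
def Compatible {V : Type*} (n : ℕ) (G : SimpleGraph V) : Prop :=
  3 ≤ n ∧ ((Odd n ∧ ∃ u : V, n ∉ L G u) ∨ (Even n ∧ ∃ u : V, n / 2 ∉ L G u))

end GraphPair

/-!
For finite graphs, `(G, H)` is stable exactly when every automorphism of `G × H` is a product of
automorphisms of the factors (`stable_iff_forall_exists_prod`).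

For `H = K₂` this means that every two-fold automorphism `(a, b)` of `G` (`u ~ v` if and only if
`a u ~ b v`) has `a = b`. A two-fold automorphism with `a ≠ b` acts on `G × H` for every bipartite
`H`, by `a` over one colour class and by `b` over the other (`TwoFold.eq_of_stable`), so
instability of `(G, K₂)` passes to `(G, C₂ₖ)`.

The converse is `stable_cycleGraph`. In `(G × C₂ₖ)*`, moving in both coordinates would force
`|N(u) ∩ N(v)| = deg u = deg v`, hence `u = v`. So `(G × C₂ₖ)*` is the Cartesian product of `G*` and
the distance-two graph of `C₂ₖ` (`auxGraph_directProd_adj`), a disjoint union of two `k`-cycles.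
An automorphism `σ` of `G × C₂ₖ` preserves it, and preserves the existence of common neighbours.
Therefore the image of a fibre `{(u, i) : i of given parity}`, a `k`-cycle, never turns from one
factor to the other (`fst_eq_of_fst_eq`): it is again a fibre, or a `k`-cycle inside a copy of `G*`.
If `k ∉ L u₀`, the second case is impossible for a fibre whose image meets the fibres over `u₀`. A
neighbouring fibre is then mapped to a fibre too, and this spreads to all fibres
(`fst_eq_of_val_mod_two_eq`). The first coordinates of `σ` on the two parity classes now form a
two-fold automorphism (`twoFold_fst`), so they agree if `(G, K₂)` is stable. The second coordinate
does not depend on the vertex of `G`, because two vertices of `C₂ₖ` have at most one common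
neighbour and any two vertices of `G` are joined by a walk of even length. Hence `σ` is a product.

Any `k > |V|` satisfies `k ∉ L u₀`, which gives the first equivalence. The remaining conditions of
nontrivial instability are routine except coprimality (`coprime_cycleGraph`): a common factor of `G`
and `C₂ₖ` is either `K₂`, making `G` bipartite, or a `k`-cycle, which puts `k` into every `L u`.
-/

namespace GraphPair

open SimpleGraph

variable {V W : Type*}

/-! ### Products of automorphisms -/

/-- The automorphism `(u, i) ↦ (α u, γ i)` of a direct product. -/
def prodAut {G : SimpleGraph V} {H : SimpleGraph W} (α : G ≃g G) (γ : H ≃g H) :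
    directProd G H ≃g directProd G H where
  toEquiv := α.toEquiv.prodCongr γ.toEquiv
  map_rel_iff' := and_congr α.map_adj_iff γ.map_adj_iff

/-- For finite graphs the abstract isomorphism in the definition of stability can only exist when
the natural embedding of `Aut G × Aut H` into `Aut (G × H)` is onto, because the orders agree. -/
theorem stable_iff_forall_exists_prod [Finite V] [Finite W] [Nonempty V] [Nonempty W]
    {G : SimpleGraph V} {H : SimpleGraph W} :
    Stable G H ↔ ∀ σ : directProd G H ≃g directProd G H,
      ∃ (α : G ≃g G) (γ : H ≃g H), ∀ p, σ p = (α p.1, γ p.2) := by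
  let Φ : (G ≃g G) × (H ≃g H) →* (directProd G H ≃g directProd G H) :=
    { toFun := fun x => prodAut x.1 x.2
      map_one' := rfl
      map_mul' := fun _ _ => rfl }
  have hΦ : Function.Injective Φ := by
    rintro ⟨α, γ⟩ ⟨α', γ'⟩ h
    have key : ∀ p : V × W, (α p.1, γ p.2) = (α' p.1, γ' p.2) := fun p => DFunLike.congr_fun h p
    obtain ⟨u⟩ := ‹Nonempty V›
    obtain ⟨i⟩ := ‹Nonempty W›
    refine Prod.ext (RelIso.ext fun v => ?_) (RelIso.ext fun j => ?_)
    · exact congrArg Prod.fst (key (v, i))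
    · exact congrArg Prod.snd (key (u, j))
  have : Finite (directProd G H ≃g directProd G H) := DFunLike.finite _
  constructor
  · rintro ⟨e⟩ σ
    have hsurj : Function.Surjective Φ := by
      have : Function.Injective (Φ ∘ e.symm) := hΦ.comp e.symm.injective
      exact (Finite.surjective_of_injective this).of_comp
    obtain ⟨x, rfl⟩ := hsurj σ
    exact ⟨x.1, x.2, fun _ => rfl⟩
  · intro h
    refine ⟨MulEquiv.ofBijective Φ ⟨hΦ, fun σ => ?_⟩⟩
    obtain ⟨α, γ, hσ⟩ := h σ
    exact ⟨(α, γ), RelIso.ext fun p => (hσ p).symm⟩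

/-- An automorphism of `G × H` acting coordinatewise through arbitrary maps is a product of
automorphisms, provided both graphs have an edge. -/
theorem exists_prod_of_coordinatewise [Finite V] [Finite W] {G : SimpleGraph V}
    {H : SimpleGraph W} {u v : V} {i j : W} (huv : G.Adj u v) (hij : H.Adj i j)
    (σ : directProd G H ≃g directProd G H) (a : V → V) (f : W → W)
    (hσ : ∀ p, σ p = (a p.1, f p.2)) :
    ∃ (α : G ≃g G) (γ : H ≃g H), ∀ p, σ p = (α p.1, γ p.2) := by
  have hadj : ∀ x y l l', (G.Adj (a x) (a y) ∧ H.Adj (f l) (f l')) ↔ (G.Adj x y ∧ H.Adj l l') := by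
    intro x y l l'
    have := σ.map_adj_iff (v := (x, l)) (w := (y, l'))
    rwa [hσ, hσ] at this
  have ha : Function.Injective a := fun x y hxy => by
    have : σ (x, i) = σ (y, i) := by rw [hσ, hσ]; simp [hxy]
    exact congrArg Prod.fst (σ.injective this)
  have hf : Function.Injective f := fun x y hxy => by
    have : σ (u, x) = σ (u, y) := by rw [hσ, hσ]; simp [hxy]
    exact congrArg Prod.snd (σ.injective this)
  have hauv := (hadj u v i j).2 ⟨huv, hij⟩
  refine ⟨⟨Equiv.ofBijective a (Finite.injective_iff_bijective.1 ha), fun {x y} => ?_⟩,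
    ⟨Equiv.ofBijective f (Finite.injective_iff_bijective.1 hf), fun {x y} => ?_⟩, hσ⟩
  · exact ⟨fun h => ((hadj x y i j).1 ⟨h, hauv.2⟩).1, fun h => ((hadj x y i j).2 ⟨h, hij⟩).1⟩
  · exact ⟨fun h => ((hadj u v x y).1 ⟨hauv.1, h⟩).2, fun h => ((hadj u v x y).2 ⟨huv, h⟩).2⟩

/-! ### Connected non-bipartite graphs -/

/-- In a connected non-bipartite graph any two vertices are joined by a walk of even length, so a
function that agrees on vertices with a common neighbour is constant. -/
theorem eq_of_forall_common_neighbor {X : Type*} {G : SimpleGraph V} (hconn : G.Connected)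
    (hbip : ¬ G.IsBipartite) (f : V → X)
    (hf : ∀ u v w, G.Adj u v → G.Adj w v → f u = f w) (u w : V) : f u = f w := by
  have key : ∀ {x y : V} (p : G.Walk x y), (Even p.length → f x = f y) ∧
      (Odd p.length → ∀ z, G.Adj z x → f z = f y) := by
    intro x y p
    induction p with
    | nil => simp
    | cons h p ih =>
      rw [Walk.length_cons]
      refine ⟨fun he => ih.2 (by grind) _ h, fun ho z hz => ?_⟩
      rw [hf _ _ _ hz h.symm]
      exact ih.1 (by grind)
  have hodd : ∃ (r : V) (p : G.Walk r r), Odd p.length := by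
    by_contra! hcon
    refine hbip (two_colorable_iff_forall_loop_even.2 fun r p => ?_)
    exact Nat.not_odd_iff_even.1 (hcon r p)
  obtain ⟨r, p, hp⟩ := hodd
  obtain ⟨q⟩ := hconn.preconnected u w
  obtain ⟨s⟩ := hconn.preconnected u r
  by_cases hq : Even q.length
  · exact (key q).1 hq
  · refine (key (((s.append p).append s.reverse).append q)).1 ?_
    simp only [Walk.length_append, Walk.length_reverse]
    grind

theorem exists_adj_of_connected_of_not_isBipartite {G : SimpleGraph V} (hconn : G.Connected)
    (hbip : ¬ G.IsBipartite) (u : V) : ∃ v, G.Adj u v := by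
  by_contra! hu
  obtain ⟨x, y, hxy⟩ : ∃ x y, G.Adj x y := by
    by_contra! hcon
    exact hbip ⟨fun _ => 0, fun {x y} h => (hcon x y h).elim⟩
  have : Nontrivial V := ⟨x, y, hxy.ne⟩
  obtain ⟨v, hv⟩ := hconn.preconnected.exists_adj_of_nontrivial u
  exact hu v hv

/-! ### Two-fold automorphisms -/

/-- The pair `(a, b)` is a two-fold automorphism of `G`: `u` is adjacent to `v` if and only if
`a u` is adjacent to `b v`. Bijectivity is not required: it is automatic in a finite `R`-thin
graph. -/
def TwoFold (G : SimpleGraph V) (a b : V → V) : Prop :=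
  ∀ u v, G.Adj u v ↔ G.Adj (a u) (b v)

theorem TwoFold.symm {G : SimpleGraph V} {a b : V → V} (h : TwoFold G a b) : TwoFold G b a :=
  fun u v => by rw [G.adj_comm, h v u, G.adj_comm]

theorem TwoFold.injective {G : SimpleGraph V} (hthin : RThin G) {a b : V → V}
    (h : TwoFold G a b) : Function.Injective a := by
  intro x y hxy
  by_contra hne
  refine hthin x y hne (Set.ext fun z => ?_)
  rw [mem_neighborSet, mem_neighborSet, h x z, h y z, hxy]

/-- A two-fold automorphism `(a, b)` with `a ≠ b` yields an automorphism of `G × H` for bipartite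
`H`, acting by `a` on one colour class and by `b` on the other, which is not a product. -/
theorem TwoFold.eq_of_stable [Finite V] [Nonempty V] [Finite W] {G : SimpleGraph V}
    {H : SimpleGraph W} (hthin : RThin G) (κ : H.Coloring Bool) {i j : W} (hij : H.Adj i j)
    (hst : Stable G H) {a b : V → V} (h : TwoFold G a b) : a = b := by
  have : Nonempty W := ⟨i⟩
  let A : Bool → V ≃ V := fun t => bif t
    then Equiv.ofBijective a (Finite.injective_iff_bijective.1 (h.injective hthin))
    else Equiv.ofBijective b (Finite.injective_iff_bijective.1 (h.symm.injective hthin))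
  have hA : ∀ s t, s ≠ t → ∀ u v, G.Adj (A s u) (A t v) ↔ G.Adj u v := by
    intro s t hst u v
    cases s <;> cases t
    · exact (hst rfl).elim
    · exact (h.symm u v).symm
    · exact (h u v).symm
    · exact (hst rfl).elim
  let σ : directProd G H ≃g directProd G H :=
    { toFun := fun p => (A (κ p.2) p.1, p.2)
      invFun := fun p => ((A (κ p.2)).symm p.1, p.2)
      left_inv := fun p => by simp
      right_inv := fun p => by simp
      map_rel_iff' := by
        rintro ⟨u, x⟩ ⟨v, y⟩
        exact and_congr_left fun hxy => hA _ _ (κ.valid hxy) u v }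
  obtain ⟨α, γ, hσ⟩ := stable_iff_forall_exists_prod.1 hst σ
  have key : ∀ l u, A (κ l) u = α u := fun l u => congrArg Prod.fst (hσ (u, l))
  have hne : κ i ≠ κ j := κ.valid hij
  have htf : ∀ s, A s = α.toEquiv := by
    intro s
    have : s = κ i ∨ s = κ j := by revert hne; cases κ i <;> cases κ j <;> cases s <;> simp
    rcases this with rfl | rfl <;> exact Equiv.ext fun u => key _ u
  funext u
  exact (DFunLike.congr_fun (htf true) u).trans (DFunLike.congr_fun (htf false) u).symm

/-- If every two-fold automorphism of `G` is diagonal then `(G, K₂)` is stable: an automorphism of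
`G × K₂` respects the two colour classes and acts on them through a two-fold automorphism. -/
theorem stable_completeGraph_two [Finite V] {G : SimpleGraph V} (hconn : G.Connected)
    (hbip : ¬ G.IsBipartite) (hG : ∀ a b : V → V, TwoFold G a b → a = b) :
    Stable G (completeGraph (Fin 2)) := by
  have : Nonempty V := hconn.nonempty
  refine stable_iff_forall_exists_prod.2 fun σ => ?_
  obtain ⟨u₀⟩ := ‹Nonempty V›
  obtain ⟨v₀, huv⟩ := exists_adj_of_connected_of_not_isBipartite hconn hbip u₀
  have hadj : ∀ u v (i j : Fin 2), i ≠ j → (G.Adj u v ↔ G.Adj (σ (u, i)).1 (σ (v, j)).1 ∧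
      (σ (u, i)).2 ≠ (σ (v, j)).2) := by
    intro u v i j hij
    rw [← and_iff_left (a := G.Adj u v) hij]
    exact (σ.map_adj_iff (v := (u, i)) (w := (v, j))).symm
  have hconst : ∀ i u w, (σ (u, i)).2 = (σ (w, i)).2 := by
    intro i
    refine eq_of_forall_common_neighbor hconn hbip _ fun u v w huv hwv => ?_
    obtain ⟨j, hj⟩ := exists_ne i
    have h₁ := ((hadj u v i j hj.symm).1 huv).2
    have h₂ := ((hadj w v i j hj.symm).1 hwv).2
    omega
  have hne : ∀ u v, (σ (u, 0)).2 ≠ (σ (v, 1)).2 := by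
    intro u v
    rw [hconst 0 u u₀, hconst 1 v v₀]
    exact ((hadj u₀ v₀ 0 1 (by decide)).1 huv).2
  have heq := hG (fun u => (σ (u, 0)).1) (fun u => (σ (u, 1)).1) fun u v =>
    (hadj u v 0 1 (by decide)).trans (and_iff_left (hne u v))
  refine exists_prod_of_coordinatewise huv (i := (0 : Fin 2)) (j := 1) (by simp) σ
    (fun u => (σ (u, 0)).1) (fun i => (σ (u₀, i)).2) ?_
  rintro ⟨u, i⟩
  refine Prod.ext ?_ (hconst i u u₀)
  fin_cases i
  · rfl
  · exact (congrFun heq u).symm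

/-! ### The auxiliary graph -/

/-- `i` and `j` are distinct and have a common neighbour. -/
def DistTwo (H : SimpleGraph W) (i j : W) : Prop :=
  i ≠ j ∧ ∃ l, H.Adj i l ∧ H.Adj j l

theorem DistTwo.symm {H : SimpleGraph W} {i j : W} (h : DistTwo H i j) : DistTwo H j i :=
  ⟨h.1.symm, h.2.imp fun _ => And.symm⟩

theorem neighborSet_directProd (G : SimpleGraph V) (H : SimpleGraph W) (p : V × W) :
    (directProd G H).neighborSet p = G.neighborSet p.1 ×ˢ H.neighborSet p.2 := rfl

theorem deg_directProd (G : SimpleGraph V) (H : SimpleGraph W) (p : V × W) :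
    deg (directProd G H) p = deg G p.1 * deg H p.2 := by
  rw [deg, neighborSet_directProd, Set.ncard_prod]; rfl

theorem ncard_common_directProd (G : SimpleGraph V) (H : SimpleGraph W) (p q : V × W) :
    ((directProd G H).neighborSet p ∩ (directProd G H).neighborSet q).ncard =
      (G.neighborSet p.1 ∩ G.neighborSet q.1).ncard *
        (H.neighborSet p.2 ∩ H.neighborSet q.2).ncard := by
  rw [neighborSet_directProd, neighborSet_directProd, Set.prod_inter_prod, Set.ncard_prod]

theorem image_neighborSet {G : SimpleGraph V} {H : SimpleGraph W} (e : G ≃g H) (u : V) :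
    e '' G.neighborSet u = H.neighborSet (e u) := by
  ext y
  constructor
  · rintro ⟨x, hx, rfl⟩
    exact e.map_adj_iff.2 hx
  · intro hy
    refine ⟨e.symm y, ?_, e.apply_symm_apply y⟩
    rw [mem_neighborSet, ← e.map_adj_iff, e.apply_symm_apply]
    exact hy

theorem deg_map_iso {G : SimpleGraph V} {H : SimpleGraph W} (e : G ≃g H) (u : V) :
    deg H (e u) = deg G u := by
  rw [deg, ← image_neighborSet, Set.ncard_image_of_injective _ e.injective]; rfl

theorem auxGraph_adj_map_iso {G : SimpleGraph V} {H : SimpleGraph W} (e : G ≃g H) (u v : V) :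
    (auxGraph H).Adj (e u) (e v) ↔ (auxGraph G).Adj u v := by
  change (_ ∧ _ ∧ _) ↔ (_ ∧ _ ∧ _)
  rw [deg_map_iso, deg_map_iso, ← image_neighborSet, ← image_neighborSet,
    ← Set.image_inter e.injective, Set.ncard_image_of_injective _ e.injective,
    e.injective.ne_iff]

theorem rThin_map_iso {G : SimpleGraph V} {H : SimpleGraph W} (e : G ≃g H) (h : RThin G) :
    RThin H := by
  intro x y hxy hN
  refine h (e.symm x) (e.symm y) (e.symm.injective.ne hxy) ?_
  rw [← image_neighborSet, ← image_neighborSet, hN]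

/-- Two distinct sets with two elements that meet do so in exactly one element. -/
theorem ncard_common_of_distTwo {H : SimpleGraph W} (hthin : RThin H) (hdeg : ∀ i, deg H i = 2)
    {i j : W} (h : DistTwo H i j) : (H.neighborSet i ∩ H.neighborSet j).ncard = 1 := by
  have fin : ∀ i, (H.neighborSet i).Finite := fun i => Set.finite_of_ncard_pos (by
    have := hdeg i; rw [deg] at this; omega)
  obtain ⟨hne, l, hil, hjl⟩ := h
  have hpos : 0 < (H.neighborSet i ∩ H.neighborSet j).ncard :=
    (Set.ncard_pos ((fin i).inter_of_left _)).2 ⟨l, hil, hjl⟩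
  by_contra hcon
  refine hthin i j hne ?_
  have h₁ : H.neighborSet i ∩ H.neighborSet j = H.neighborSet i :=
    Set.eq_of_subset_of_ncard_le Set.inter_subset_left (by
      have := hdeg i; rw [deg] at this; omega) (fin i)
  have h₂ : H.neighborSet i ∩ H.neighborSet j = H.neighborSet j :=
    Set.eq_of_subset_of_ncard_le Set.inter_subset_right (by
      have := hdeg j; rw [deg] at this; omega) (fin j)
  exact h₁.symm.trans h₂

theorem auxGraph_directProd_adj_of_distTwo {G : SimpleGraph V} {H : SimpleGraph W}
    (hthin : RThin H) (hdeg : ∀ i, deg H i = 2) (u : V) {i j : W} (h : DistTwo H i j) :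
    (auxGraph (directProd G H)).Adj (u, i) (u, j) := by
  refine ⟨fun hij => h.1 (congrArg Prod.snd hij), ?_, ?_⟩
  · simp [deg_directProd, hdeg]
  · rw [deg_directProd, ncard_common_directProd, ncard_common_of_distTwo hthin hdeg h, hdeg,
      Set.inter_self, mul_one, mul_comm]
    rfl

/-- For `H` a disjoint union of cycles, thin, the auxiliary graph of `G × H` is the Cartesian
product of the auxiliary graph of `G` with the distance-two graph of `H`. Moving in both
coordinates at once would force `|N(u) ∩ N(v)| = deg u = deg v`, which thinness excludes. -/
theorem auxGraph_directProd_adj [Finite V] {G : SimpleGraph V} {H : SimpleGraph W}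
    (hG : RThin G) (hpos : ∀ u, ∃ v, G.Adj u v) (hthin : RThin H) (hdeg : ∀ i, deg H i = 2)
    {p q : V × W} : (auxGraph (directProd G H)).Adj p q ↔
      ((auxGraph G).Adj p.1 q.1 ∧ p.2 = q.2) ∨ (p.1 = q.1 ∧ DistTwo H p.2 q.2) := by
  obtain ⟨u, i⟩ := p
  obtain ⟨v, j⟩ := q
  by_cases hij : i = j
  · subst hij
    have h2 := hdeg i
    rw [deg] at h2
    change (_ ∧ _ ∧ _) ↔ ((_ ∧ _ ∧ _) ∧ _) ∨ _
    rw [deg_directProd, deg_directProd, ncard_common_directProd, Set.inter_self, hdeg, h2]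
    have : (u, i) ≠ (v, i) ↔ u ≠ v := by simp
    rw [this]
    constructor
    · rintro ⟨hne, h₁, h₂⟩
      exact Or.inl ⟨⟨hne, by simpa using h₁, by simp only at h₂ ⊢; omega⟩, rfl⟩
    · rintro (⟨⟨hne, h₁, h₂⟩, -⟩ | ⟨-, h⟩)
      · exact ⟨hne, by simpa using h₁, by simp only at h₂ ⊢; omega⟩
      · exact (h.1 rfl).elim
  · by_cases hd : DistTwo H i j
    · constructor
      · rintro ⟨-, h₁, h₂⟩
        rw [deg_directProd, deg_directProd, hdeg, hdeg] at h₁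
        rw [deg_directProd, ncard_common_directProd, hdeg,
          ncard_common_of_distTwo hthin hdeg hd] at h₂
        simp only [deg] at h₁ h₂
        have e₁ : G.neighborSet u ∩ G.neighborSet v = G.neighborSet u :=
          Set.eq_of_subset_of_ncard_le Set.inter_subset_left (by omega)
        have e₂ : G.neighborSet u ∩ G.neighborSet v = G.neighborSet v :=
          Set.eq_of_subset_of_ncard_le Set.inter_subset_right (by omega)
        refine Or.inr ⟨?_, hd⟩
        by_contra hne
        exact hG u v hne (e₁.symm.trans e₂)
      · rintro (⟨-, h⟩ | ⟨rfl, h⟩)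
        · exact (hij h).elim
        · exact auxGraph_directProd_adj_of_distTwo hthin hdeg _ h
    · have hempty : H.neighborSet i ∩ H.neighborSet j = ∅ :=
        Set.eq_empty_of_forall_notMem fun l hl => hd ⟨hij, l, hl.1, hl.2⟩
      refine ⟨fun ⟨_, _, h₂⟩ => ?_, ?_⟩
      · rw [deg_directProd, ncard_common_directProd, hdeg, hempty, Set.ncard_empty] at h₂
        obtain ⟨w, hw⟩ := hpos v
        have : 0 < deg G v := (Set.ncard_pos).2 ⟨w, hw⟩
        simp only at h₂
        omega
      · rintro (⟨-, h⟩ | ⟨-, h⟩)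
        · exact (hij h).elim
        · exact (hd h).elim

theorem exists_common_neighbor_of_auxGraph_adj [Finite V] {G : SimpleGraph V}
    (hpos : ∀ u, ∃ v, G.Adj u v) {u v : V} (h : (auxGraph G).Adj u v) :
    ∃ w, G.Adj u w ∧ G.Adj v w := by
  obtain ⟨x, hx⟩ := hpos v
  have : 0 < deg G v := (Set.ncard_pos).2 ⟨x, hx⟩
  have h2 := h.2.2
  exact (Set.ncard_pos).1 (by omega : 0 < (G.neighborSet u ∩ G.neighborSet v).ncard)

/-- The image of a path `(u, i), (u, j), (u, l)` of the auxiliary graph under an automorphism of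
`G × H` does not turn from one factor to the other. At a turn the two ends would have a common
neighbour without being adjacent in the auxiliary graph, which never happens for `(u, i)` and
`(u, l)`. -/
theorem fst_eq_of_fst_eq [Finite V] {G : SimpleGraph V} {H : SimpleGraph W}
    (hG : RThin G) (hpos : ∀ u, ∃ v, G.Adj u v) (hthin : RThin H) (hdeg : ∀ i, deg H i = 2)
    (σ : directProd G H ≃g directProd G H) (u : V) {i j l : W} (hij : DistTwo H i j)
    (hjl : DistTwo H j l) (hil : i ≠ l) (h : (σ (u, i)).1 = (σ (u, j)).1) :
    (σ (u, j)).1 = (σ (u, l)).1 := by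
  by_contra hcon
  have haux : ∀ {p q}, (auxGraph (directProd G H)).Adj p q ↔ _ :=
    auxGraph_directProd_adj hG hpos hthin hdeg
  have hσ : ∀ {i j}, DistTwo H i j → (auxGraph (directProd G H)).Adj (σ (u, i)) (σ (u, j)) :=
    fun hd => (auxGraph_adj_map_iso σ _ _).2 (haux.2 (Or.inr ⟨rfl, hd⟩))
  obtain ⟨hadj, h₂⟩ := (haux.1 (hσ hjl)).resolve_right fun h' => hcon h'.1
  have hd := ((haux.1 (hσ hij)).resolve_left fun h' => h'.1.ne h).2
  obtain ⟨w, hw₁, hw₂⟩ := exists_common_neighbor_of_auxGraph_adj hpos hadj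
  obtain ⟨y, hy₁, hy₂⟩ := hd.2
  have hc₁ : (directProd G H).Adj (σ (u, i)) (w, y) := ⟨by rw [h]; exact hw₁, hy₁⟩
  have hc₂ : (directProd G H).Adj (σ (u, l)) (w, y) := ⟨hw₂, by rw [← h₂]; exact hy₂⟩
  rw [← σ.apply_symm_apply (w, y), σ.map_adj_iff] at hc₁ hc₂
  rcases haux.1 (hσ ⟨hil, _, hc₁.2, hc₂.2⟩) with ⟨-, h'⟩ | ⟨h', -⟩
  · exact hd.1 (h'.trans h₂.symm)
  · exact hadj.ne (h.symm.trans h')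

/-- A closed sequence of `k` distinct vertices of the auxiliary graph, consecutive ones being
adjacent, puts `k` into `L`. -/
theorem mem_L_of_closed_sequence [Finite V] {G : SimpleGraph V} {k : ℕ} (hk : 3 ≤ k) (w : ℕ → V)
    (hadj : ∀ t, (auxGraph G).Adj (w t) (w (t + 1)))
    (hinj : ∀ s t, s < t → t < k → w s ≠ w t) (hclosed : w k = w 0) : k ∈ L G (w 0) := by
  obtain ⟨n, rfl⟩ : ∃ n, k = n + 3 := ⟨k - 3, by omega⟩
  have hdeg : 2 ≤ deg (auxGraph G) (w 0) := by
    have hne : w 1 ≠ w (n + 2) := hinj _ _ (by omega) (by omega)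
    rw [deg, ← Set.ncard_pair hne]
    refine Set.ncard_le_ncard (Set.insert_subset (hadj 0) (Set.singleton_subset_iff.2 ?_))
    rw [mem_neighborSet, ← hclosed]
    exact (hadj (n + 2)).symm
  let f : cycleGraph (n + 3) →g auxGraph G :=
    { toFun := fun i => w i.val
      map_rel' := by
        have key : ∀ i j : Fin (n + 3), (i - j).val = 1 → (auxGraph G).Adj (w j) (w i) := by
          intro i j h
          have hi := i.isLt
          have hj := j.isLt
          rcases le_or_gt j i with hij | hij
          · rw [Fin.coe_sub_iff_le.2 hij] at h
            have : i.val = j.val + 1 := by omega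
            rw [this]; exact hadj _
          · rw [Fin.coe_sub_iff_lt.2 hij] at h
            have h0 : i.val = 0 := by omega
            have h1 : j.val = n + 2 := by omega
            rw [h0, h1, ← hclosed]; exact hadj _
        intro i j h
        rcases cycleGraph_adj'.1 h with h | h
        · exact (key _ _ h).symm
        · exact key _ _ h }
  have hf : Function.Injective f :=
    Function.Injective.of_lt_imp_ne fun i j hij => hinj _ _ hij j.isLt
  rw [L, if_neg (by omega), if_neg (by omega)]
  refine ⟨(cycleGraph.cycle n).map f, (cycleGraph.isCycle_cycle).map hf, ?_⟩
  exact (Walk.length_map f _).trans cycleGraph.length_cycle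

/-! ### Cycles -/

/-- The vertex of the cycle on `Fin m` reached from `0` after `j` steps. -/
def cyc (m : ℕ) [NeZero m] (j : ℕ) : Fin m := Fin.ofNat m j

section Cycle

variable {m : ℕ} [NeZero m]

theorem cyc_val (i : Fin m) : cyc m i.val = i := Fin.ofNat_val_eq_self i

theorem cyc_add_self (j : ℕ) : cyc m (j + m) = cyc m j := Fin.ext (Nat.add_mod_right j m)

theorem cyc_eq_iff {i j : ℕ} : cyc m i = cyc m j ↔ i ≡ j [MOD m] := Fin.ext_iff

theorem cyc_ne_cyc_of_lt {i j : ℕ} (hij : i < j) (hji : j < i + m) : cyc m i ≠ cyc m j := by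
  rw [Ne, cyc_eq_iff]
  intro h
  have := Nat.le_of_dvd (by omega) ((Nat.modEq_iff_dvd' (by omega)).1 h)
  omega

theorem cycleGraph_adj_cyc_succ (hm : 2 ≤ m) (j : ℕ) :
    (cycleGraph m).Adj (cyc m j) (cyc m (j + 1)) := by
  obtain ⟨n, rfl⟩ : ∃ n, m = n + 2 := ⟨m - 2, by omega⟩
  rw [cycleGraph_adj]
  right
  have : cyc (n + 2) (j + 1) = cyc (n + 2) j + 1 := by
    ext; simp [cyc, Fin.val_add]
  rw [this, add_sub_cancel_left]

theorem neighborSet_cyc_succ (hm : 2 ≤ m) (j : ℕ) :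
    (cycleGraph m).neighborSet (cyc m (j + 1)) = {cyc m j, cyc m (j + 2)} := by
  obtain ⟨n, rfl⟩ : ∃ n, m = n + 2 := ⟨m - 2, by omega⟩
  have h₁ : cyc (n + 2) (j + 1) = cyc (n + 2) j + 1 := by
    ext; simp [cyc, Fin.val_add]
  have h₂ : cyc (n + 2) (j + 2) = cyc (n + 2) (j + 1) + 1 := by
    ext; simp [cyc, Fin.val_add]
  rw [cycleGraph_neighborSet, h₂, h₁, add_sub_cancel_right]

theorem exists_eq_cyc_succ (i : Fin m) : ∃ j, i = cyc m (j + 1) := by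
  refine ⟨i.val + (m - 1), ?_⟩
  have : i.val + (m - 1) + 1 = i.val + m := by have := NeZero.pos m; omega
  rw [this, cyc_add_self, cyc_val]

theorem deg_cycleGraph (hm : 3 ≤ m) (i : Fin m) : deg (cycleGraph m) i = 2 := by
  obtain ⟨j, rfl⟩ := exists_eq_cyc_succ i
  rw [deg, neighborSet_cyc_succ (by omega), Set.ncard_pair (cyc_ne_cyc_of_lt (by omega) (by omega))]

theorem rThin_cycleGraph (hm : 5 ≤ m) : RThin (cycleGraph m) := by
  intro i i' hne hN
  obtain ⟨j, rfl⟩ := exists_eq_cyc_succ i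
  -- A second vertex adjacent to `cyc (j + 2)` is `cyc (j + 3)`, which is not adjacent to `cyc j`.
  have h₂ : cyc m (j + 2) ∈ (cycleGraph m).neighborSet i' := by
    rw [← hN, neighborSet_cyc_succ (by omega)]; simp
  have h₀ : cyc m j ∈ (cycleGraph m).neighborSet i' := by
    rw [← hN, neighborSet_cyc_succ (by omega)]; simp
  have h₃ : i' ∈ (cycleGraph m).neighborSet (cyc m (j + 1 + 1)) := Adj.symm h₂
  rw [neighborSet_cyc_succ (by omega)] at h₃
  obtain rfl := (h₃ : _ ∨ _).resolve_left hne.symm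
  have h : cyc m j ∈ (cycleGraph m).neighborSet (cyc m (j + 2 + 1)) := h₀
  rw [neighborSet_cyc_succ (by omega)] at h
  rcases h with h | h
  · exact cyc_ne_cyc_of_lt (by omega) (by omega) h
  · exact cyc_ne_cyc_of_lt (by omega) (by omega) h

theorem distTwo_cyc (hm : 3 ≤ m) (j : ℕ) :
    DistTwo (cycleGraph m) (cyc m j) (cyc m (j + 2)) :=
  ⟨cyc_ne_cyc_of_lt (by omega) (by omega), cyc m (j + 1), cycleGraph_adj_cyc_succ (by omega) j,
    (cycleGraph_adj_cyc_succ (by omega) (j + 1)).symm⟩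

theorem common_neighbor_unique_cycleGraph (hm : 5 ≤ m) {i j l l' : Fin m} (hij : i ≠ j)
    (h₁ : (cycleGraph m).Adj l i) (h₂ : (cycleGraph m).Adj l j)
    (h₁' : (cycleGraph m).Adj l' i) (h₂' : (cycleGraph m).Adj l' j) : l = l' := by
  have h := ncard_common_of_distTwo (rThin_cycleGraph hm) (deg_cycleGraph (by omega))
    ⟨hij, l, h₁.symm, h₂.symm⟩
  exact ((Set.ncard_le_one (Set.toFinite _)).1 h.le) l ⟨h₁.symm, h₂.symm⟩ l' ⟨h₁'.symm, h₂'.symm⟩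

theorem val_mod_two_cyc (hm : Even m) (j : ℕ) : (cyc m j).val % 2 = j % 2 :=
  Nat.mod_mod_of_dvd j hm.two_dvd

theorem val_mod_two_ne_of_adj (hm : Even m) {i j : Fin m} (h : (cycleGraph m).Adj i j) :
    i.val % 2 ≠ j.val % 2 := by
  have hm2 : 2 ≤ m := by have := NeZero.pos m; grind
  obtain ⟨n, rfl⟩ := exists_eq_cyc_succ i
  have h' : j ∈ (cycleGraph m).neighborSet (cyc m (n + 1)) := h
  rw [neighborSet_cyc_succ hm2] at h'
  rcases h' with rfl | rfl <;> rw [val_mod_two_cyc hm, val_mod_two_cyc hm] <;> omega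

end Cycle

/-! ### Automorphisms of products with an even cycle -/

section Fibres

variable [Finite V] {G : SimpleGraph V} {m : ℕ} [NeZero m]

theorem fst_eq_fst_succ_iff (hG : RThin G) (hpos : ∀ u, ∃ v, G.Adj u v) (hm : 5 ≤ m)
    (σ : directProd G (cycleGraph m) ≃g directProd G (cycleGraph m)) (u : V) (j : ℕ) :
    (σ (u, cyc m j)).1 = (σ (u, cyc m (j + 2))).1 ↔
      (σ (u, cyc m (j + 2))).1 = (σ (u, cyc m (j + 4))).1 := by
  have key := fun {i j l} => fst_eq_of_fst_eq (i := i) (j := j) (l := l) hG hpos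
    (rThin_cycleGraph hm) (deg_cycleGraph (by omega)) σ u
  have h₁ := distTwo_cyc (m := m) (by omega) j
  have h₂ := distTwo_cyc (m := m) (by omega) (j + 2)
  have hne : cyc m j ≠ cyc m (j + 4) := cyc_ne_cyc_of_lt (by omega) (by omega)
  exact ⟨key h₁ h₂ hne, fun h => (key h₂.symm h₁.symm hne.symm h.symm).symm⟩

theorem fst_eq_fst_add_iff (hG : RThin G) (hpos : ∀ u, ∃ v, G.Adj u v) (hm : 5 ≤ m)
    (σ : directProd G (cycleGraph m) ≃g directProd G (cycleGraph m)) (u : V) (j t : ℕ) :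
    (σ (u, cyc m j)).1 = (σ (u, cyc m (j + 2))).1 ↔
      (σ (u, cyc m (j + 2 * t))).1 = (σ (u, cyc m (j + 2 * t + 2))).1 := by
  induction t with
  | zero => rfl
  | succ t ih => exact ih.trans (fst_eq_fst_succ_iff hG hpos hm σ u (j + 2 * t))

/-- A step of the image of a fibre that changes the first coordinate is a step of the auxiliary
graph of `G` and keeps the second coordinate. -/
theorem auxGraph_adj_of_fst_ne (hG : RThin G) (hpos : ∀ u, ∃ v, G.Adj u v) (hm : 5 ≤ m)
    (σ : directProd G (cycleGraph m) ≃g directProd G (cycleGraph m)) (u : V) (j : ℕ)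
    (h : (σ (u, cyc m j)).1 ≠ (σ (u, cyc m (j + 2))).1) :
    (auxGraph G).Adj (σ (u, cyc m j)).1 (σ (u, cyc m (j + 2))).1 ∧
      (σ (u, cyc m j)).2 = (σ (u, cyc m (j + 2))).2 := by
  have hthin := rThin_cycleGraph hm
  have hdeg : ∀ i, deg (cycleGraph m) i = 2 := deg_cycleGraph (by omega)
  have := (auxGraph_adj_map_iso σ _ _).2
    (auxGraph_directProd_adj_of_distTwo hthin hdeg u (distTwo_cyc (m := m) (by omega) j))
  exact ((auxGraph_directProd_adj hG hpos hthin hdeg).1 this).resolve_right fun h' => h h'.1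

/-- If the image of one fibre is a fibre then so is the image of every adjacent fibre: otherwise
the latter has a constant second coordinate, with three neighbours in the cycle. -/
theorem fst_eq_of_adj (hG : RThin G) (hpos : ∀ u, ∃ v, G.Adj u v) (hm : 5 ≤ m)
    (σ : directProd G (cycleGraph m) ≃g directProd G (cycleGraph m)) {u v : V} (huv : G.Adj u v)
    {j : ℕ} (h : (σ (u, cyc m j)).1 = (σ (u, cyc m (j + 2))).1) :
    (σ (v, cyc m (j + 1))).1 = (σ (v, cyc m (j + 3))).1 := by
  by_contra hcon
  have hconst := (auxGraph_adj_of_fst_ne hG hpos hm σ v (j + 1) hcon).2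
  have h' := (fst_eq_fst_succ_iff hG hpos hm σ u j).1 h
  have hadj : ∀ i i', (cycleGraph m).Adj i i' → (cycleGraph m).Adj (σ (u, i)).2 (σ (v, i')).2 :=
    fun i i' hii => (σ.map_adj_iff.2 (show (directProd G _).Adj (u, i) (v, i') from ⟨huv, hii⟩)).2
  have hstep := cycleGraph_adj_cyc_succ (m := m) (by omega)
  have hne : ∀ i i', (σ (u, i)).1 = (σ (u, i')).1 → i ≠ i' → (σ (u, i)).2 ≠ (σ (u, i')).2 :=
    fun i i' h₁ hii h₂ => hii (congrArg Prod.snd (σ.injective (Prod.ext h₁ h₂)))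
  have hsub : ({(σ (u, cyc m j)).2, (σ (u, cyc m (j + 2))).2, (σ (u, cyc m (j + 4))).2} : Set _) ⊆
      (cycleGraph m).neighborSet (σ (v, cyc m (j + 1))).2 := by
    rintro x (rfl | rfl | rfl)
    · exact (hadj _ _ (hstep j)).symm
    · exact (hadj _ _ (hstep (j + 1)).symm).symm
    · rw [hconst]
      exact (hadj _ _ (hstep (j + 3)).symm).symm
  have hcard := Set.ncard_le_ncard hsub
  have hdeg := deg_cycleGraph (m := m) (by omega) (σ (v, cyc m (j + 1))).2
  rw [deg] at hdeg
  rw [hdeg, Set.ncard_eq_three.2 ⟨_, _, _,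
    hne _ _ h (cyc_ne_cyc_of_lt (by omega) (by omega)),
    hne _ _ (h.trans h') (cyc_ne_cyc_of_lt (by omega) (by omega)),
    hne _ _ h' (cyc_ne_cyc_of_lt (by omega) (by omega)), rfl⟩] at hcard
  omega

end Fibres

section EvenCycle

variable [Finite V] {G : SimpleGraph V} {k : ℕ}

/-- If some vertex lies on no cycle of length `k` of the auxiliary graph, every automorphism of
`G × C₂ₖ` maps fibres (the sets of all `(u, i)` with `u` and the parity of `i` fixed) to fibres.
The fibre whose image contains a vertex over `u₀` is mapped to a fibre, since otherwise its image
would be a `k`-cycle of the auxiliary graph of `G` through `u₀`; connectedness spreads this to all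
fibres. -/
theorem fst_eq_of_val_mod_two_eq (hG : RThin G) (hconn : G.Connected) (hbip : ¬ G.IsBipartite)
    (hk : 3 ≤ k) {u₀ : V} (hu₀ : k ∉ L G u₀)
    (σ : directProd G (cycleGraph (2 * k)) ≃g directProd G (cycleGraph (2 * k))) (u : V)
    {i j : Fin (2 * k)} (hij : i.val % 2 = j.val % 2) : (σ (u, i)).1 = (σ (u, j)).1 := by
  have : NeZero (2 * k) := ⟨by omega⟩
  have hpos := exists_adj_of_connected_of_not_isBipartite hconn hbip
  have hm : 5 ≤ 2 * k := by omega
  let P : ℕ → V → Prop := fun j u => (σ (u, cyc (2 * k) j)).1 = (σ (u, cyc (2 * k) (j + 2))).1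
  have hstart : ∃ u j, P j u := by
    obtain ⟨⟨u, i⟩, hui⟩ := σ.surjective (u₀, cyc (2 * k) 0)
    rw [← cyc_val i] at hui
    generalize i.val = j at hui
    refine ⟨u, j, ?_⟩
    by_contra hcon
    have hne : ∀ t, ¬ P (j + 2 * t) u := fun t ht =>
      hcon ((fst_eq_fst_add_iff hG hpos hm σ u j t).2 ht)
    have hstep := fun t => auxGraph_adj_of_fst_ne hG hpos hm σ u (j + 2 * t) (hne t)
    have hsnd : ∀ t, (σ (u, cyc (2 * k) (j + 2 * t))).2 = (σ (u, cyc (2 * k) j)).2 := by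
      intro t
      induction t with
      | zero => rfl
      | succ t ih => exact (hstep t).2.symm.trans ih
    have h0 : (σ (u, cyc (2 * k) (j + 2 * 0))).1 = u₀ := congrArg Prod.fst hui
    apply hu₀
    rw [← h0]
    refine mem_L_of_closed_sequence hk (fun t => (σ (u, cyc (2 * k) (j + 2 * t))).1)
      (fun t => (hstep t).1) (fun s t hst htk heq => ?_) ?_
    · have := congrArg Prod.snd (σ.injective (Prod.ext heq ((hsnd s).trans (hsnd t).symm)))
      exact cyc_ne_cyc_of_lt (by omega) (by omega) this
    · simp only [mul_zero, add_zero, cyc_add_self]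
  have hadj : ∀ {u v j}, G.Adj u v → P j u → P (j + 1) v :=
    fun huv h => fst_eq_of_adj hG hpos hm σ huv h
  have hshift : ∀ j t u, P j u ↔ P (j + 2 * t) u := fun j t u =>
    fst_eq_fst_add_iff hG hpos hm σ u j t
  have hconst : ∀ j u w, P j u = P j w := fun j =>
    eq_of_forall_common_neighbor hconn hbip (P j) fun u v w huv hwv => propext
      ⟨fun h => (hshift j 1 w).2 (hadj hwv.symm (hadj huv h)),
        fun h => (hshift j 1 u).2 (hadj huv.symm (hadj hwv h))⟩
  obtain ⟨x, n, hx⟩ := hstart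
  obtain ⟨y, hxy⟩ := hpos x
  have hall : ∀ j v, P j v := by
    intro j v
    -- `j + 2 n` has the parity of `n` or of `n + 1`, according to the parity of `j + n`.
    rw [hshift j n v]
    rcases Nat.even_or_odd' (j + n) with ⟨c, hc | hc⟩
    · rw [show j + 2 * n = n + 2 * c by omega, ← hshift, hconst n v x]
      exact hx
    · rw [show j + 2 * n = n + 1 + 2 * c by omega, ← hshift, hconst (n + 1) v y]
      exact hadj hxy hx
  have hmul : ∀ e t, (σ (u, cyc (2 * k) (e + 2 * t))).1 = (σ (u, cyc (2 * k) e)).1 := by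
    intro e t
    induction t with
    | zero => rfl
    | succ t ih => exact (hall (e + 2 * t) u).symm.trans ih
  rw [← cyc_val i, ← cyc_val j, ← Nat.mod_add_div i.val 2, ← Nat.mod_add_div j.val 2, hmul, hmul,
    hij]

/-- When fibres go to fibres, the first coordinate of an automorphism of `G × C₂ₖ` gives a
two-fold automorphism of `G`. -/
theorem twoFold_fst (hG : RThin G) (hconn : G.Connected) (hbip : ¬ G.IsBipartite)
    (hk : 3 ≤ k) {u₀ : V} (hu₀ : k ∉ L G u₀) [NeZero (2 * k)]
    (σ : directProd G (cycleGraph (2 * k)) ≃g directProd G (cycleGraph (2 * k))) :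
    TwoFold G (fun u => (σ (u, cyc (2 * k) 0)).1) (fun u => (σ (u, cyc (2 * k) 1)).1) := by
  have hev : Even (2 * k) := even_two_mul k
  have hpos := exists_adj_of_connected_of_not_isBipartite hconn hbip
  have hadj : ∀ {u v i j}, G.Adj u v → (cycleGraph (2 * k)).Adj i j →
      (directProd G (cycleGraph (2 * k))).Adj (σ (u, i)) (σ (v, j)) :=
    fun huv hij => σ.map_adj_iff.2 ⟨huv, hij⟩
  have h01 : (cycleGraph (2 * k)).Adj (cyc (2 * k) 0) (cyc (2 * k) 1) :=
    cycleGraph_adj_cyc_succ (by omega) 0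
  refine fun u v => ⟨fun huv => (hadj huv h01).1, fun huv => ?_⟩
  -- The images of the two colour classes lie in different colour classes.
  have hconst : ∀ u w, (σ (u, cyc (2 * k) 0)).2.val % 2 = (σ (w, cyc (2 * k) 0)).2.val % 2 := by
    refine eq_of_forall_common_neighbor hconn hbip _ fun u v w huv hwv => ?_
    have h₁ := val_mod_two_ne_of_adj hev (hadj huv h01).2
    have h₂ := val_mod_two_ne_of_adj hev (hadj hwv h01).2
    omega
  have hne : (σ (u, cyc (2 * k) 0)).2.val % 2 ≠ (σ (v, cyc (2 * k) 1)).2.val % 2 := by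
    obtain ⟨w, hvw⟩ := hpos v
    rw [hconst u w]
    exact val_mod_two_ne_of_adj hev (hadj hvw.symm h01).2
  obtain ⟨l, hl⟩ : ∃ l, (cycleGraph (2 * k)).Adj (σ (u, cyc (2 * k) 0)).2 l := by
    rw [← cyc_val (σ (u, cyc (2 * k) 0)).2]
    exact ⟨_, cycleGraph_adj_cyc_succ (by omega) _⟩
  have hpar : l.val % 2 = (σ (v, cyc (2 * k) 1)).2.val % 2 := by
    have := val_mod_two_ne_of_adj hev hl
    omega
  have hfst := fst_eq_of_val_mod_two_eq hG hconn hbip hk hu₀ σ.symm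
    (σ (v, cyc (2 * k) 1)).1 hpar
  rw [Prod.mk.eta, σ.symm_apply_apply] at hfst
  have h : (directProd G (cycleGraph (2 * k))).Adj (σ (u, cyc (2 * k) 0))
      ((σ (v, cyc (2 * k) 1)).1, l) := ⟨huv, hl⟩
  rw [← σ.symm.map_adj_iff, σ.symm_apply_apply] at h
  have hadj' := h.1
  rwa [hfst] at hadj'

/-- If `k` is missing from some `L u` and every two-fold automorphism of `G` is diagonal, then
`(G, C₂ₖ)` is stable. -/
theorem stable_cycleGraph (hG : RThin G) (hconn : G.Connected) (hbip : ¬ G.IsBipartite)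
    (hk : 3 ≤ k) {u₀ : V} (hu₀ : k ∉ L G u₀) (hTF : ∀ a b : V → V, TwoFold G a b → a = b) :
    Stable G (cycleGraph (2 * k)) := by
  have : NeZero (2 * k) := ⟨by omega⟩
  have : Nonempty V := ⟨u₀⟩
  have hpos := exists_adj_of_connected_of_not_isBipartite hconn hbip
  obtain ⟨v₀, huv₀⟩ := hpos u₀
  refine stable_iff_forall_exists_prod.2 fun σ => ?_
  have hfst : ∀ u i, (σ (u, i)).1 = (σ (u, cyc (2 * k) 0)).1 := by
    intro u i
    have h01 := congrFun (hTF _ _ (twoFold_fst hG hconn hbip hk hu₀ σ)) u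
    rcases Nat.mod_two_eq_zero_or_one i.val with h | h
    · exact fst_eq_of_val_mod_two_eq hG hconn hbip hk hu₀ σ u
        (by rw [h, val_mod_two_cyc (even_two_mul k)])
    · refine (fst_eq_of_val_mod_two_eq hG hconn hbip hk hu₀ σ u (j := cyc (2 * k) 1)
        (by rw [h, val_mod_two_cyc (even_two_mul k)])).trans h01.symm
  have hadj : ∀ {u v i j}, G.Adj u v → (cycleGraph (2 * k)).Adj i j →
      (cycleGraph (2 * k)).Adj (σ (u, i)).2 (σ (v, j)).2 :=
    fun {u v i j} huv hij => (σ.map_adj_iff.2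
      (show (directProd G (cycleGraph (2 * k))).Adj (u, i) (v, j) from ⟨huv, hij⟩)).2
  -- Vertices `u`, `w` with a common neighbour `v` have the same second coordinate at `i`: it is
  -- the common neighbour of the two distinct second coordinates of `v` around `i`.
  have hsnd : ∀ i u w, (σ (u, i)).2 = (σ (w, i)).2 := by
    intro i
    obtain ⟨n, rfl⟩ := exists_eq_cyc_succ i
    refine eq_of_forall_common_neighbor hconn hbip _ fun u v w huv hwv => ?_
    have h₁ := (cycleGraph_adj_cyc_succ (m := 2 * k) (by omega) n).symm
    have h₂ := cycleGraph_adj_cyc_succ (m := 2 * k) (by omega) (n + 1)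
    refine common_neighbor_unique_cycleGraph (by omega) (fun heq => ?_) (hadj huv h₁)
      (hadj huv h₂) (hadj hwv h₁) (hadj hwv h₂)
    have := σ.injective (Prod.ext ((hfst v _).trans (hfst v _).symm) heq)
    exact cyc_ne_cyc_of_lt (by omega) (by omega) (congrArg Prod.snd this : cyc _ n = cyc _ (n + 2))
  exact exists_prod_of_coordinatewise huv₀ (cycleGraph_adj_cyc_succ (by omega) 0) σ
    (fun u => (σ (u, cyc (2 * k) 0)).1) (fun i => (σ (u₀, i)).2) fun p => Prod.ext (hfst p.1 p.2) (hsnd p.2 p.1 u₀)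

/-! ### Coprimality -/

theorem apply_eq_of_deg_eq_one {W : Type*} {H : SimpleGraph W} (hdeg : ∀ x, deg H x = 1)
    (f : ℕ → W) (hf : ∀ t, H.Adj (f t) (f (t + 1))) (j t : ℕ) : f (j + 2 * t) = f j := by
  have hstep : ∀ t, f (t + 2) = f t := by
    intro t
    obtain ⟨x, hx⟩ := Set.ncard_eq_one.1 (hdeg (f (t + 1)))
    have h₁ : f (t + 2) ∈ ({x} : Set W) := hx ▸ hf (t + 1)
    have h₂ : f t ∈ ({x} : Set W) := hx ▸ (hf t).symm
    exact h₁.trans h₂.symm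
  induction t with
  | zero => rfl
  | succ t ih => exact (hstep (j + 2 * t)).trans ih

/-- A common factor of `G` and `C₂ₖ` is regular of degree `1` or `2`. In the first case it is `K₂`
and `G` is bipartite; in the second it is a cycle of length `k`, which gives rise to cycles of
length `k` through all vertices of the auxiliary graph of `G`. -/
theorem coprime_cycleGraph (hbip : ¬ G.IsBipartite) (hk : 3 ≤ k) {u₀ : V} (hu₀ : k ∉ L G u₀) :
    Coprime G (cycleGraph (2 * k)) := by
  rintro ⟨a, b, d, A, B, D, -, ⟨ψ⟩, ⟨φ⟩⟩
  have : NeZero (2 * k) := ⟨by omega⟩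
  have hwalk : ∀ t, (directProd B D).Adj (φ (cyc (2 * k) t)) (φ (cyc (2 * k) (t + 1))) :=
    fun t => φ.map_adj_iff.2 (cycleGraph_adj_cyc_succ (by omega) t)
  have hsurj : ∀ p, ∃ t, φ (cyc (2 * k) t) = p := fun p =>
    ⟨(φ.symm p).val, by rw [cyc_val, φ.apply_symm_apply]⟩
  have hprod : ∀ x y, deg B x * deg D y = 2 := by
    intro x y
    obtain ⟨t, ht⟩ := hsurj (x, y)
    rw [← deg_directProd B D (x, y), ← ht, deg_map_iso, deg_cycleGraph (by omega)]
  by_cases hB : ∃ x, deg B x = 1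
  · obtain ⟨x, hx⟩ := hB
    have hD2 : ∀ y, deg D y = 2 := fun y => by simpa [hx] using hprod x y
    have hB1 : ∀ x, deg B x = 1 := fun x => by
      have h := hprod x (φ (cyc (2 * k) 0)).2
      rw [hD2] at h
      omega
    have hthin : RThin D := by
      intro y y' hne hN
      refine rThin_map_iso φ (rThin_cycleGraph (by omega)) (x, y) (x, y')
        (fun h => hne (congrArg Prod.snd h)) ?_
      rw [neighborSet_directProd, neighborSet_directProd, hN]
    have hfst : ∀ j t, (φ (cyc (2 * k) (j + 2 * t))).1 = (φ (cyc (2 * k) j)).1 :=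
      apply_eq_of_deg_eq_one hB1 (fun t => (φ (cyc (2 * k) t)).1) fun t => (hwalk t).1
    have hinj : ∀ j t, 0 < t → t < k →
        (φ (cyc (2 * k) j)).2 ≠ (φ (cyc (2 * k) (j + 2 * t))).2 := fun j t h₀ htk h =>
      cyc_ne_cyc_of_lt (by omega) (by omega) (φ.injective (Prod.ext (hfst j t).symm h))
    obtain ⟨j, hj⟩ := hsurj (x, (ψ u₀).2)
    let w : ℕ → V := fun t => ψ.symm ((ψ u₀).1, (φ (cyc (2 * k) (j + 2 * t))).2)
    have hw0 : w 0 = u₀ := by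
      change ψ.symm ((ψ u₀).1, (φ (cyc (2 * k) j)).2) = u₀
      rw [hj, Prod.mk.eta, ψ.symm_apply_apply]
    apply hu₀
    rw [← hw0]
    refine mem_L_of_closed_sequence hk w (fun t => ?_) (fun s t hst htk heq => ?_) ?_
    · refine (auxGraph_adj_map_iso ψ.symm _ _).2
        (auxGraph_directProd_adj_of_distTwo hthin hD2 _ ⟨?_, ?_⟩)
      · exact hinj (j + 2 * t) 1 (by omega) (by omega)
      · exact ⟨_, (hwalk (j + 2 * t)).2, (hwalk (j + 2 * t + 1)).2.symm⟩
    · refine hinj (j + 2 * s) (t - s) (by omega) (by omega) ?_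
      rw [show j + 2 * s + 2 * (t - s) = j + 2 * t by omega]
      exact (Prod.mk.inj (ψ.symm.injective heq)).2
    · simp only [w, mul_zero, add_zero, cyc_add_self]
  · have hD1 : ∀ y, deg D y = 1 := by
      intro y
      have h := hprod (φ (cyc (2 * k) 0)).1 y
      have hdvd := (Nat.dvd_prime Nat.prime_two).1 (Dvd.intro _ h)
      rw [hdvd.resolve_left fun h' => hB ⟨_, h'⟩] at h
      omega
    have hsnd : ∀ j t, (φ (cyc (2 * k) (j + 2 * t))).2 = (φ (cyc (2 * k) j)).2 :=
      apply_eq_of_deg_eq_one hD1 (fun t => (φ (cyc (2 * k) t)).2) fun t => (hwalk t).2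
    have htwo : ∀ y, y = (φ (cyc (2 * k) 0)).2 ∨ y = (φ (cyc (2 * k) 1)).2 := by
      intro y
      obtain ⟨t, ht⟩ := hsurj ((φ (cyc (2 * k) 0)).1, y)
      have hy : y = (φ (cyc (2 * k) t)).2 := by rw [ht]
      rw [hy, ← Nat.mod_add_div t 2, hsnd]
      rcases Nat.mod_two_eq_zero_or_one t with h | h <;> simp [h]
    classical
    refine hbip ⟨fun u => if (ψ u).2 = (φ (cyc (2 * k) 0)).2 then 0 else 1, fun {u v} huv => ?_⟩
    have hne := (ψ.map_adj_iff.2 huv).2.ne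
    rcases htwo (ψ u).2 with h₁ | h₁ <;> rcases htwo (ψ v).2 with h₂ | h₂
    · exact (hne (h₁.trans h₂.symm)).elim
    · rw [h₁] at hne
      simp [h₁, hne.symm]
    · rw [h₂] at hne
      simp [h₂, hne]
    · exact (hne (h₁.trans h₂.symm)).elim

theorem unstable_cycleGraph_of_unstable_completeGraph (hG : RThin G) (hconn : G.Connected)
    (hbip : ¬ G.IsBipartite) (h : Unstable G (completeGraph (Fin 2))) (hk : 1 ≤ k) :
    Unstable G (cycleGraph (2 * k)) := by
  intro hst
  have : NeZero (2 * k) := ⟨by omega⟩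
  have : Nonempty V := hconn.nonempty
  exact h (stable_completeGraph_two hconn hbip fun a b hab => hab.eq_of_stable hG
    (cycleGraph.bicoloring_of_even _ (even_two_mul k))
    (cycleGraph_adj_cyc_succ (by omega) 0) hst)

theorem unstable_completeGraph_of_unstable_cycleGraph (hG : RThin G) (hconn : G.Connected)
    (hbip : ¬ G.IsBipartite) (hk : 3 ≤ k) {u₀ : V} (hu₀ : k ∉ L G u₀)
    (h : Unstable G (cycleGraph (2 * k))) : Unstable G (completeGraph (Fin 2)) := by
  intro hst
  have : Nonempty V := ⟨u₀⟩
  have κ : (completeGraph (Fin 2)).Coloring Bool := Coloring.mk (fun i => decide (i = 0)) (by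
    decide)
  exact h (stable_cycleGraph hG hconn hbip hk hu₀ fun a b hab => hab.eq_of_stable hG κ
    (i := (0 : Fin 2)) (j := 1) (by simp) hst)

/-- A cycle has at most as many vertices as the graph containing it. -/
theorem notMem_L_of_card_lt [Nonempty V] (hk : 2 ≤ k) (hcard : Nat.card V < k) (u : V) :
    k ∉ L G u := by
  rw [L]
  split_ifs
  · simp; omega
  · simp; omega
  · rintro ⟨p, hp, rfl⟩
    have := Fintype.ofFinite V
    rw [Nat.card_eq_fintype_card] at hcard
    have h := hp.support_nodup.length_le_card
    simp only [List.length_tail, Walk.length_support] at h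
    omega

end EvenCycle

theorem exists_notMem_L_of_compatible {G : SimpleGraph V} {k : ℕ}
    (h : Compatible (2 * k) G) : ∃ u, k ∉ L G u := by
  rcases h.2 with ⟨hodd, -⟩ | ⟨-, hu⟩
  · exact (Nat.not_odd_iff_even.2 (even_two_mul k) hodd).elim
  · rwa [Nat.mul_div_cancel_left k two_pos] at hu

end GraphPair

theorem theorem1p2 {V : Type*} [Finite V] (G : SimpleGraph V)
    (hthin : GraphPair.RThin G) (hconn : G.Connected) (hbip : ¬ G.IsBipartite) :
    (GraphPair.Unstable G (SimpleGraph.completeGraph (Fin 2)) ↔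
      ∀ k : ℕ, 2 ≤ k → GraphPair.Unstable G (SimpleGraph.cycleGraph (2 * k))) ∧
    (∀ k : ℕ, 3 ≤ k → GraphPair.Compatible (2 * k) G →
      (GraphPair.NontriviallyUnstable G (SimpleGraph.cycleGraph (2 * k)) ↔
        GraphPair.Unstable G (SimpleGraph.completeGraph (Fin 2)))) ∧
    ((∃ k : ℕ, 3 ≤ k ∧ GraphPair.Compatible (2 * k) G ∧
        GraphPair.NontriviallyUnstable G (SimpleGraph.cycleGraph (2 * k))) →
      ∀ l : ℕ, 3 ≤ l → GraphPair.Unstable G (SimpleGraph.cycleGraph (2 * l))) := by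
  open GraphPair in
  have : Nonempty V := hconn.nonempty
  have hforward : ∀ k, 1 ≤ k → Unstable G (SimpleGraph.completeGraph (Fin 2)) →
      Unstable G (SimpleGraph.cycleGraph (2 * k)) := fun k hk h =>
    unstable_cycleGraph_of_unstable_completeGraph hthin hconn hbip h hk
  refine ⟨⟨fun h k hk => hforward k (by omega) h, fun h => ?_⟩, fun k hk hcomp => ?_, ?_⟩
  · obtain ⟨u₀⟩ := ‹Nonempty V›
    -- Larger than every cycle length in the auxiliary graph, so `2 * k` is compatible with `G`.
    let k := Nat.card V + 3
    exact unstable_completeGraph_of_unstable_cycleGraph hthin hconn hbip (k := k) (u₀ := u₀)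
      (by omega) (notMem_L_of_card_lt (by omega) (by omega) u₀) (h k (by omega))
  · obtain ⟨u₀, hu₀⟩ := exists_notMem_L_of_compatible hcomp
    refine ⟨fun h => unstable_completeGraph_of_unstable_cycleGraph hthin hconn hbip hk hu₀ h.1,
      fun h => ⟨hforward k (by omega) h, hthin, ?_, hconn, ?_,
        coprime_cycleGraph hbip hk hu₀, Or.inl hbip⟩⟩
    · have : NeZero (2 * k) := ⟨by omega⟩
      exact rThin_cycleGraph (by omega)
    · obtain ⟨n, hn⟩ : ∃ n, 2 * k = n + 1 := ⟨2 * k - 1, by omega⟩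
      rw [hn]
      exact SimpleGraph.cycleGraph_connected
  · rintro ⟨k, hk, hcomp, h⟩ l hl
    obtain ⟨u₀, hu₀⟩ := exists_notMem_L_of_compatible hcomp
    exact hforward l (by omega)
      (unstable_completeGraph_of_unstable_cycleGraph hthin hconn hbip hk hu₀ h.1)
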